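/- All languages are over the alphabet $\{0,1\}$. A deterministic oracle Turing machine $M$ is \emph{polynomial-time} if there is a polynomial $p$ such that, with every oracle, $M$ halts on every input $x$ within $p(|x|)$ steps; $L(M^B)$ is the set of strings that $M$ accepts with oracle $B$. It is \emph{positive} if $L(M^A)\subseteq L(M^B)$ for all $A\subseteq B\subseteq\{0,1\}^*$. A set $L$ \emph{positive Turing reduces} to $L'$ in polynomial time ($L\le^p_{pos}L'$) if there is a polynomial-time positive deterministic oracle Turing machine $M$ with $L=L(M^{L'})$. Let $\mathrm{DP}=\{A\cap B : A\in\mathrm{NP},\ B\in\mathrm{coNP}\}$, let $\mathrm{R}^p_{pos}(\mathrm{DP})=\{L : \exists L'\in\mathrm{DP},\ L\le^p_{pos}L'\}$, and let $\mathrm{P}^{\mathrm{NP}}$ be the class of sets $L(M^B)$ with $M$ a deterministic polynomial-time oracle Turing machine and $B\in\mathrm{NP}$. \textbf{Theorem.} $\mathrm{R}^p_{pos}(\mathrm{DP})=\mathrm{P}^{\mathrm{NP}}$. -/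

import Mathlib

/-!
Deterministic oracle Turing machines, nondeterministic Turing machines, the classes NP, coNP, DP,
polynomial-time (positive) Turing reductions, and reducibility closures. All languages are over the
alphabet `{0, 1}`, represented by `Bool`.
-/

namespace PosTuring

open Turing

/-- A language over `{0, 1}`: a set of words. -/
abbrev Lang : Type := Set (List Bool)

/-- Tape symbols of a machine with extra work symbols `W`: the blank `none`, the two letters
`some (Sum.inl b)`, and the work symbols `some (Sum.inr w)`. -/
abbrev Sym (W : Type) : Type := Option (Bool ⊕ W)

/-- A letter as a tape symbol. -/
abbrev bit {W : Type} (b : Bool) : Sym W := some (Sum.inl b)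

/-- The two-way infinite tape holding the word `x`, otherwise blank, with the head on the first
letter of `x`. -/
def inputTape (W : Type) (x : List Bool) : Tape (Sym W) := Tape.mk₁ (x.map bit)

/-- One action on a tape: write `a.1` in the scanned cell and then move the head one cell in the
direction `a.2` (`none`: the head does not move). -/
def applyAction {W : Type} (T : Tape (Sym W)) (a : Sym W × Option Dir) : Tape (Sym W) :=
  match a.2 with
  | none => T.write a.1
  | some d => (T.write a.1).move d

/-- The longest prefix of a list of tape symbols that consists of letters. -/
def letterPrefix {W : Type} : List (Sym W) → List Bool
  | some (Sum.inl b) :: l => b :: letterPrefix l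
  | _ => []

theorem letterPrefix_append_blanks {W : Type} (l : List (Sym W)) (n : ℕ) :
    letterPrefix (l ++ List.replicate n default) = letterPrefix l := by
  induction l with
  | nil => cases n <;> rfl
  | cons a l ih =>
    rcases a with _ | (b | w)
    · rfl
    · exact congrArg (List.cons b) ih
    · rfl

/-- The word written on a tape: the letters from the scanned cell rightwards, up to the first cell
that does not hold a letter. -/
def scannedWord {W : Type} (T : Tape (Sym W)) : List Bool :=
  T.right₀.liftOn letterPrefix (by
    rintro a b ⟨n, rfl⟩
    exact (letterPrefix_append_blanks a n).symm)

/-! ### Deterministic oracle machines -/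

/-- What an oracle machine with `t` tapes, states `Q` and work symbols `W` does in a state:
halt and accept, halt and reject, ask the oracle and continue in the state `yes` or `no` according
to the answer, or, depending on the `t` scanned symbols, act on all the tapes and change state. -/
inductive Instr (t : ℕ) (Q W : Type) : Type
  | accept : Instr t Q W
  | reject : Instr t Q W
  | query (yes no : Q) : Instr t Q W
  | act (f : (Fin t → Sym W) → Q × (Fin t → Sym W × Option Dir)) : Instr t Q W

/-- A deterministic multitape oracle Turing machine. Tape `0` is the input tape, tape `1` is the
query tape, and there are `k` further tapes; all of them can be read and written. -/
structure OracleTM where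
  /-- the number of additional work tapes -/
  k : ℕ
  /-- the states -/
  Q : Type
  /-- the work symbols besides the blank and the letters -/
  W : Type
  [finiteQ : Finite Q]
  [finiteW : Finite W]
  /-- the initial state -/
  start : Q
  /-- the program -/
  prog : Q → Instr (k + 2) Q W

namespace OracleTM

/-- A configuration: a state and the tapes with their head positions. -/
structure Cfg (M : OracleTM) where
  /-- the current state -/
  state : M.Q
  /-- the tapes -/
  tape : Fin (M.k + 2) → Tape (Sym M.W)

variable (M : OracleTM)

/-- The initial configuration on input `x`: all the tapes but the input tape are blank. -/
def init (x : List Bool) : M.Cfg where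
  state := M.start
  tape := fun i => if i = 0 then inputTape M.W x else inputTape M.W []

open Classical in
/-- One step of the machine with oracle `X`. A halted configuration does not change any more. A
query costs one step, asks about the word on the query tape and leaves all the tapes unchanged. -/
noncomputable def step (X : Lang) (c : M.Cfg) : M.Cfg :=
  match M.prog c.state with
  | .accept => c
  | .reject => c
  | .query yes no => ⟨if scannedWord (c.tape 1) ∈ X then yes else no, c.tape⟩
  | .act f =>
    let r := f fun i => (c.tape i).head
    ⟨r.1, fun i => applyAction (c.tape i) (r.2 i)⟩

/-- The configuration after `n` steps on input `x` with oracle `X`. -/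
noncomputable def run (X : Lang) (x : List Bool) (n : ℕ) : M.Cfg :=
  (M.step X)^[n] (M.init x)

/-- A configuration that has accepted. -/
def Accepting (c : M.Cfg) : Prop := M.prog c.state = .accept

/-- A configuration that has halted. -/
def Halted (c : M.Cfg) : Prop := M.prog c.state = .accept ∨ M.prog c.state = .reject

/-- `L(M^X)`: the words that the machine accepts with oracle `X`. -/
def language (X : Lang) : Lang := {x | ∃ n, M.Accepting (M.run X x n)}

/-- There is a polynomial `p` such that, for every oracle, the machine halts on every input `x`
after at most `p(|x|)` steps. -/
def PolyTime : Prop :=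
  ∃ p : Polynomial ℕ, ∀ (X : Lang) (x : List Bool), M.Halted (M.run X x (p.eval x.length))

/-- A machine is positive if a larger oracle never makes it accept less. -/
def Positive : Prop := ∀ A B : Lang, A ⊆ B → M.language A ⊆ M.language B

end OracleTM

/-- `A ≤_T^p B`: polynomial-time Turing reducibility. -/
def TuringReduces (A B : Lang) : Prop :=
  ∃ M : OracleTM, M.PolyTime ∧ A = M.language B

/-- `A ≤_pos^p B`: polynomial-time positive Turing reducibility. -/
def PosTuringReduces (A B : Lang) : Prop :=
  ∃ M : OracleTM, M.PolyTime ∧ M.Positive ∧ A = M.language B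

/-- `R_r(C)`: the languages that reduce to some language in `C` by the reducibility `r`. -/
def ReductionClosure (r : Lang → Lang → Prop) (C : Set Lang) : Set Lang :=
  {L | ∃ L' ∈ C, r L L'}

/-! ### Nondeterministic machines -/

/-- A nondeterministic one-tape Turing machine without oracle. -/
structure NTM where
  /-- the states -/
  Q : Type
  /-- the work symbols besides the blank and the letters -/
  W : Type
  [finiteQ : Finite Q]
  [finiteW : Finite W]
  /-- the initial state -/
  start : Q
  /-- the accepting states -/
  acc : Set Q
  /-- the possible next states and actions, given the state and the scanned symbol -/
  δ : Q → Sym W → Set (Q × (Sym W × Option Dir))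

namespace NTM

/-- A configuration: a state and the tape with the head position. -/
structure Cfg (M : NTM) where
  /-- the current state -/
  state : M.Q
  /-- the tape -/
  tape : Tape (Sym M.W)

variable (M : NTM)

/-- The initial configuration on input `x`. -/
def init (x : List Bool) : M.Cfg := ⟨M.start, inputTape M.W x⟩

/-- `Step c c'`: the configuration `c'` is a possible successor of `c`. A computation stops when it
reaches an accepting state, and when no transition applies. -/
def Step (c c' : M.Cfg) : Prop :=
  c.state ∉ M.acc ∧ ∃ r ∈ M.δ c.state c.tape.head, c' = ⟨r.1, applyAction c.tape r.2⟩

/-- `Reaches n c c'`: some computation of exactly `n` steps leads from `c` to `c'`. -/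
inductive Reaches : ℕ → M.Cfg → M.Cfg → Prop
  | refl (c : M.Cfg) : Reaches 0 c c
  | tail {n : ℕ} {c c' c'' : M.Cfg} : Reaches n c c' → M.Step c' c'' → Reaches (n + 1) c c''

/-- `L(M)`: the words on which some computation reaches an accepting state. -/
def language : Lang := {x | ∃ n c, M.Reaches n (M.init x) c ∧ c.state ∈ M.acc}

/-- There is a polynomial `p` such that every computation on every input `x` has at most `p(|x|)`
steps. -/
def PolyTime : Prop :=
  ∃ p : Polynomial ℕ, ∀ (x : List Bool) (n : ℕ) (c : M.Cfg),
    M.Reaches n (M.init x) c → n ≤ p.eval x.length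

end NTM

/-- NP: the languages of nondeterministic polynomial-time Turing machines. -/
def NP : Set Lang := {L | ∃ M : NTM, M.PolyTime ∧ L = M.language}

/-- coNP: the languages whose complement is in NP. -/
def coNP : Set Lang := {L | Lᶜ ∈ NP}

/-- DP: the intersections of an NP language with a coNP language. -/
def DP : Set Lang := {C | ∃ A ∈ NP, ∃ B ∈ coNP, C = A ∩ B}

/-- P^NP: the languages that are decided in deterministic polynomial time with an NP oracle. -/
def PNP : Set Lang := ReductionClosure TuringReduces NP

end PosTuring

/-! From DP into P^NP: a query to `A ∩ B` can be answered by one query to `A` and one to `Bᶜ`, both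
in NP, and NP is closed under the marked union `join`, so a single NP oracle serves both.

Conversely, let `M` decide `L` with oracle `B ∈ NP`. The marked union of `Bᶜ` (letter 0) and `B`
(letter 1) is in DP. Replace each query `q` of `M` by the two queries `0q` and `1q`. With the true
oracle exactly one is answered yes, and the simulation goes on. With any other oracle, two yes
answers accept at once and two no answers reject at once. This forces positivity: when the oracle
grows, either the smaller one rejects at a query, or the larger one accepts, or both give the same
consistent pair and the runs stay equal (`run_double_mono`).

Both directions use one construction, `double`, with different rules `g` for combining the two
answers. -/

namespace PosTuring

open Turing

/-! ### The disjoint union of two NP languages -/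

/-- The disjoint union of two languages, marked by the first letter. -/
def join (L : Bool → Lang) : Lang := {y | ∃ b x, y = b :: x ∧ x ∈ L b}

@[simp] theorem cons_mem_join {L : Bool → Lang} {b : Bool} {x : List Bool} :
    b :: x ∈ join L ↔ x ∈ L b := by
  simp only [join, Set.mem_ofPred_eq, List.cons.injEq]
  constructor
  · rintro ⟨b, x, ⟨rfl, rfl⟩, h⟩; exact h
  · exact fun h => ⟨b, x, ⟨rfl, rfl⟩, h⟩

@[simp] theorem nil_notMem_join {L : Bool → Lang} : [] ∉ join L := by
  rintro ⟨b, x, h, -⟩; cases h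

theorem eval_mono (p : Polynomial ℕ) {m n : ℕ} (h : m ≤ n) : p.eval m ≤ p.eval n := by
  simp only [Polynomial.eval_eq_sum, Polynomial.sum]
  gcongr

/-! ### Nondeterministic machines for marked unions -/

namespace NTM

/-- A machine's symbols as symbols of the joined machine. -/
def symMap (M : Bool → NTM) (b : Bool) : PointedMap (Sym (M b).W) (Sym (Σ b, (M b).W)) where
  f := Option.map (Sum.map id (Sigma.mk (β := fun b => (M b).W) b))
  map_pt' := rfl

theorem symMap_injective (M : Bool → NTM) (b : Bool) : Function.Injective (symMap M b) :=
  Option.map_injective (Sum.map_injective.2 ⟨Function.injective_id, sigma_mk_injective⟩)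

/-- The machine that removes the first letter `b` of its input and then runs `M b`. -/
def join (M : Bool → NTM) : NTM :=
  haveI := fun b => (M b).finiteQ
  haveI := fun b => (M b).finiteW
  { Q := Option (Σ b, (M b).Q)
    W := Σ b, (M b).W
    start := none
    acc := {s | ∃ b q, s = some ⟨b, q⟩ ∧ q ∈ (M b).acc}
    δ := fun
      | none, s => {r | ∃ b, s = bit b ∧ r = (some ⟨b, (M b).start⟩, (none, some Dir.right))}
      | some ⟨b, q⟩, s => {r | ∃ s₀ r₀, symMap M b s₀ = s ∧ r₀ ∈ (M b).δ q s₀ ∧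
          r = (some ⟨b, r₀.1⟩, (symMap M b r₀.2.1, r₀.2.2))} }

/-- A configuration of `M b` as a configuration of the joined machine. -/
def joinCfg (M : Bool → NTM) (b : Bool) (c : (M b).Cfg) : (join M).Cfg :=
  ⟨some ⟨b, c.state⟩, c.tape.map (symMap M b)⟩

variable {M : Bool → NTM}

theorem joinCfg_mem_acc {b : Bool} {c : (M b).Cfg} :
    (joinCfg M b c).state ∈ (join M).acc ↔ c.state ∈ (M b).acc := by
  constructor
  · rintro ⟨b', q, h, hq⟩
    cases h
    exact hq
  · exact fun h => ⟨b, c.state, rfl, h⟩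

theorem map_applyAction (b : Bool) (T : Tape (Sym (M b).W)) (a : Sym (M b).W × Option Dir) :
    (applyAction T a).map (symMap M b) =
      applyAction (T.map (symMap M b)) (symMap M b a.1, a.2) := by
  rcases a with ⟨s, _ | d⟩
  · exact Tape.map_write _ _ _
  · exact (Tape.map_move _ _ _).trans (congrArg (Tape.move d) (Tape.map_write _ _ _))

/-- The joined machine's transitions are defined through preimages of the scanned symbol;
injectivity of `symMap` makes the preimage unique, so no spurious transitions arise. -/
theorem join_step_joinCfg {b : Bool} {c : (M b).Cfg} {d : (join M).Cfg} :
    (join M).Step (joinCfg M b c) d ↔ ∃ c', (M b).Step c c' ∧ d = joinCfg M b c' := by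
  constructor
  · rintro ⟨hacc, r, ⟨s₀, r₀, hs, hr₀, rfl⟩, rfl⟩
    have hs' : s₀ = c.tape.head := by
      apply symMap_injective M b
      rw [hs]
      exact Tape.map_fst _ _
    subst hs'
    refine ⟨⟨r₀.1, applyAction c.tape r₀.2⟩,
      ⟨fun h => hacc (joinCfg_mem_acc.2 h), r₀, hr₀, rfl⟩, ?_⟩
    exact congrArg (Cfg.mk _) (map_applyAction b _ _).symm
  · rintro ⟨c', ⟨hacc, r₀, hr₀, rfl⟩, rfl⟩
    refine ⟨fun h => hacc (joinCfg_mem_acc.1 h), _,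
      ⟨c.tape.head, r₀, (Tape.map_fst _ _).symm, hr₀, rfl⟩, ?_⟩
    exact congrArg (Cfg.mk _) (map_applyAction b _ _)

/-- The erased cell merges with the infinite blank part to the left of the head, so no shifting of
the input is needed. -/
theorem applyAction_erase_cons {W : Type} (b : Bool) (x : List Bool) :
    applyAction (inputTape W (b :: x)) (none, some Dir.right) = inputTape W x := by
  have h : ListBlank.cons (none : Sym W) (ListBlank.mk []) = ListBlank.mk [] :=
    ListBlank.cons_head_tail (ListBlank.mk ([] : List (Sym W)))
  simp only [applyAction, inputTape, Tape.mk₁, Tape.mk₂, Tape.mk', List.map_cons, Tape.write,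
    Tape.move, h, ListBlank.head_mk, ListBlank.tail_mk, List.tail_cons]

theorem map_inputTape (b : Bool) (x : List Bool) :
    (inputTape (M b).W x).map (symMap M b) = inputTape (Σ b, (M b).W) x := by
  simp only [inputTape, Tape.map_mk₁, List.map_map]
  rfl

theorem join_step_init {y : List Bool} {d : (join M).Cfg} :
    (join M).Step ((join M).init y) d ↔
      ∃ b x, y = b :: x ∧ d = joinCfg M b ((M b).init x) := by
  have key : ∀ b x, (⟨some ⟨b, (M b).start⟩, applyAction (inputTape _ (b :: x))
      (none, some Dir.right)⟩ : (join M).Cfg) = joinCfg M b ((M b).init x) := fun b x =>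
    congrArg (Cfg.mk _) ((applyAction_erase_cons b x).trans (map_inputTape b x).symm)
  constructor
  · rintro ⟨-, r, ⟨b, hb, rfl⟩, rfl⟩
    cases y with
    | nil => cases hb
    | cons b' x =>
      cases hb
      exact ⟨b, x, rfl, key b x⟩
  · rintro ⟨b, x, rfl, rfl⟩
    refine ⟨?_, _, ⟨b, rfl, rfl⟩, (key b x).symm⟩
    rintro ⟨b, q, h, -⟩
    cases h

theorem reaches_join {y : List Bool} {n : ℕ} {d : (join M).Cfg} :
    (join M).Reaches n ((join M).init y) d ↔ (n = 0 ∧ d = (join M).init y) ∨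
      ∃ m b x c, n = m + 1 ∧ y = b :: x ∧ (M b).Reaches m ((M b).init x) c ∧
        d = joinCfg M b c := by
  constructor
  · intro h
    generalize hc : (join M).init y = c₀ at h
    induction h with
    | refl => exact .inl ⟨rfl, rfl⟩
    | tail _ hs ih =>
      right
      rcases ih hc with ⟨rfl, rfl⟩ | ⟨m, b, x, c, rfl, rfl, hr, rfl⟩
      · subst hc
        obtain ⟨b, x, rfl, rfl⟩ := join_step_init.1 hs
        exact ⟨0, b, x, _, rfl, rfl, .refl _, rfl⟩
      · obtain ⟨c', hc', rfl⟩ := join_step_joinCfg.1 hs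
        exact ⟨m + 1, b, x, c', rfl, rfl, hr.tail hc', rfl⟩
  · rintro (⟨rfl, rfl⟩ | ⟨m, b, x, c, rfl, rfl, hr, rfl⟩)
    · exact .refl _
    · generalize hc : (M b).init x = c₀ at hr
      induction hr with
      | refl c =>
        subst hc
        exact (Reaches.refl _).tail (join_step_init.2 ⟨b, x, rfl, rfl⟩)
      | tail _ hs ih => exact (ih hc).tail (join_step_joinCfg.2 ⟨_, hs, rfl⟩)

theorem language_join (M : Bool → NTM) :
    (join M).language = PosTuring.join fun b => (M b).language := by
  ext y
  constructor
  · rintro ⟨n, d, hd, hacc⟩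
    rcases reaches_join.1 hd with ⟨-, rfl⟩ | ⟨m, b, x, c, -, rfl, hr, rfl⟩
    · obtain ⟨b, q, h, -⟩ := hacc
      cases h
    · exact ⟨b, x, rfl, m, c, hr, joinCfg_mem_acc.1 hacc⟩
  · rintro ⟨b, x, rfl, m, c, hr, hacc⟩
    exact ⟨m + 1, _, reaches_join.2 (.inr ⟨m, b, x, c, rfl, rfl, hr, rfl⟩),
      joinCfg_mem_acc.2 hacc⟩

theorem PolyTime.join (h : ∀ b, (M b).PolyTime) : (NTM.join M).PolyTime := by
  choose p hp using h
  -- The summand 1 pays for erasing the marker; `M b` runs on a word one letter shorter, hence the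
  -- appeal to monotonicity.
  refine ⟨p false + p true + 1, fun y n d hr => ?_⟩
  simp only [Polynomial.eval_add, Polynomial.eval_one]
  rcases reaches_join.1 hr with ⟨rfl, -⟩ | ⟨m, b, x, c, rfl, rfl, hr, -⟩
  · exact Nat.zero_le _
  · have h₁ := hp b x m c hr
    have h₂ := eval_mono (p b) (Nat.le_succ x.length)
    simp only [List.length_cons]
    cases b <;> simp only [Nat.succ_eq_add_one] at h₂ <;> omega

/-- The machine that halts at once, with the verdict `v`. -/
def const (v : Prop) : NTM where
  Q := Unit
  W := Empty
  start := ()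
  acc := {_s | v}
  δ := fun _ _ => ∅

theorem reaches_const {v : Prop} {n : ℕ} {c c' : (const v).Cfg} (h : (const v).Reaches n c c') :
    n = 0 := by
  cases h with
  | refl => rfl
  | tail _ hs =>
    obtain ⟨-, r, hr, -⟩ := hs
    exact hr.elim

theorem const_polyTime (v : Prop) : (const v).PolyTime :=
  ⟨0, fun _ _ _ h => (reaches_const h).le.trans (Nat.zero_le _)⟩

theorem language_const (v : Prop) : (const v).language = {_x | v} := by
  ext x
  exact ⟨fun ⟨_, _, _, h⟩ => h, fun h => ⟨0, _, .refl _, h⟩⟩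

end NTM

/-! ### Marked unions in NP and in DP -/

theorem join_mem_NP {L : Bool → Lang} (h : ∀ b, L b ∈ NP) : join L ∈ NP := by
  choose M hM hL using h
  refine ⟨NTM.join M, NTM.PolyTime.join hM, ?_⟩
  rw [NTM.language_join]
  congr 1
  exact funext hL

theorem univ_mem_NP : (Set.univ : Lang) ∈ NP :=
  ⟨NTM.const True, NTM.const_polyTime _, (NTM.language_const _).symm⟩

theorem empty_mem_NP : (∅ : Lang) ∈ NP :=
  ⟨NTM.const False, NTM.const_polyTime _, (NTM.language_const _).symm⟩

/-- The NP part constrains only words marked 1 and the coNP part only words marked 0. The empty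
word, which lies in the complement, is excluded by the NP part. -/
theorem join_compl_mem_DP {B : Lang} (h : B ∈ NP) : join (fun b => if b then B else Bᶜ) ∈ DP := by
  refine ⟨join (fun b => if b then B else Set.univ), join_mem_NP ?_,
    (join fun b => if b then ∅ else B)ᶜ, ?_, ?_⟩
  · rintro (_ | _)
    exacts [univ_mem_NP, h]
  · rw [coNP, Set.mem_ofPred_eq, compl_compl]
    refine join_mem_NP ?_
    rintro (_ | _)
    exacts [h, empty_mem_NP]
  · ext y
    rcases y with _ | ⟨_ | _, x⟩ <;> simp

/-! ### Replacing each query by two queries -/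

namespace OracleTM

section Basic

variable {M : OracleTM} {X : Lang}

theorem step_of_halted {c : M.Cfg} (h : M.Halted c) : M.step X c = c := by
  rcases h with h | h <;> simp only [step, h]

theorem step_iterate_of_halted {c : M.Cfg} (h : M.Halted c) (n : ℕ) : (M.step X)^[n] c = c :=
  Function.iterate_fixed (step_of_halted h) n

theorem run_add (x : List Bool) (m n : ℕ) : M.run X x (n + m) = (M.step X)^[n] (M.run X x m) :=
  Function.iterate_add_apply _ _ _ _

theorem run_eq_of_halted {x : List Bool} {m n : ℕ} (h : M.Halted (M.run X x m)) (hmn : m ≤ n) :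
    M.run X x n = M.run X x m := by
  obtain ⟨k, rfl⟩ := Nat.exists_eq_add_of_le hmn
  rw [Nat.add_comm, run_add, step_iterate_of_halted h]

theorem run_eq_run_of_halted {x : List Bool} {m n : ℕ} (hm : M.Halted (M.run X x m))
    (hn : M.Halted (M.run X x n)) : M.run X x m = M.run X x n := by
  rcases le_total m n with h | h
  · exact (run_eq_of_halted hm h).symm
  · exact run_eq_of_halted hn h

theorem mem_language_iff_of_halted {x : List Bool} {n : ℕ} (h : M.Halted (M.run X x n)) :
    x ∈ M.language X ↔ M.Accepting (M.run X x n) := by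
  constructor
  · rintro ⟨m, hm⟩
    rwa [← run_eq_run_of_halted (Or.inl hm) h]
  · exact fun h => ⟨n, h⟩

end Basic

/-- The stages of the simulation of one query. -/
inductive Stage : Type
  | sim | peek | ask₀ | flip | ask₁ | restore | halt

instance : Finite Stage :=
  Finite.of_surjective
    (fun n : Fin 7 => [Stage.sim, .peek, .ask₀, .flip, .ask₁, .restore, .halt].get n)
    fun s => by
      cases s
      exacts [⟨0, rfl⟩, ⟨1, rfl⟩, ⟨2, rfl⟩, ⟨3, rfl⟩, ⟨4, rfl⟩, ⟨5, rfl⟩, ⟨6, rfl⟩]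

/-- The action that changes only the query tape. -/
def queryTapeAct {k : ℕ} {W : Type} (f : Fin (k + 2) → Sym W) (a : Sym W × Option Dir) :
    Fin (k + 2) → Sym W × Option Dir :=
  fun i => if i = 1 then a else (f i, none)

/-- Where the simulation of a query with the two answers `a` and `b` continues: `Sum.inl` stands
for an answer to the simulated query, `Sum.inr` for a verdict. -/
def continuation {Q S : Type} (s₀ : S) (yes no : Q) :
    Bool ⊕ Bool → Q × Stage × S × Bool × Bool
  | .inl v => (if v then yes else no, .sim, s₀, false, false)
  -- The state `no` is a filler: at stage `halt` only the verdict matters.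
  | .inr v => (no, .halt, s₀, v, v)

/-- The machine that runs `M`, but replaces a query about `q` by queries about `0q` and `1q` and
continues with the answer, or halts with the verdict, that `g` assigns to the two answers. The
cell to the left of the query word is used for the additional letter and restored afterwards. -/
def double (M : OracleTM) (g : Bool → Bool → Bool ⊕ Bool) : OracleTM :=
  haveI := M.finiteQ
  haveI := M.finiteW
  { k := M.k
    Q := M.Q × Stage × Sym M.W × Bool × Bool
    W := M.W
    start := (M.start, .sim, none, false, false)
    prog := fun
      | (_, .halt, _, v, _) => if v then .accept else .reject
      | (q, st, s, a, b) =>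
        match M.prog q with
        | .accept => .accept
        | .reject => .reject
        | .act f => .act fun h => (((f h).1, .sim, none, false, false), (f h).2)
        | .query yes no =>
          match st with
          | .sim => .act fun h =>
              ((q, .peek, none, false, false), queryTapeAct h (h 1, some Dir.left))
          | .peek => .act fun h =>
              ((q, .ask₀, h 1, false, false), queryTapeAct h (bit false, none))
          | .ask₀ => .query (q, .flip, s, true, false) (q, .flip, s, false, false)
          | .flip => .act fun h => ((q, .ask₁, s, a, false), queryTapeAct h (bit true, none))
          | .ask₁ => .query (q, .restore, s, a, true) (q, .restore, s, a, false)
          | .restore => .act fun h =>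
              (continuation none yes no (g a b), queryTapeAct h (s, some Dir.right))
          | .halt => .reject }

variable {M : OracleTM} {g : Bool → Bool → Bool ⊕ Bool} {X : Lang}

/-- The configurations of `M.double g`. -/
def stageCfg (M : OracleTM) (g : Bool → Bool → Bool ⊕ Bool)
    (q : M.Q × Stage × Sym M.W × Bool × Bool) (T : Fin (M.k + 2) → Tape (Sym M.W)) :
    (M.double g).Cfg :=
  ⟨q, T⟩

/-- A configuration of `M` as a configuration of `M.double g`. -/
def doubleCfg (M : OracleTM) (g : Bool → Bool → Bool ⊕ Bool) (c : M.Cfg) : (M.double g).Cfg :=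
  stageCfg M g (c.state, .sim, none, false, false) c.tape

open Classical in
/-- The answer of the oracle `X` about `q`. -/
noncomputable def answer (X : Lang) (q : List Bool) : Bool := decide (q ∈ X)

@[simp] theorem answer_eq_true {X : Lang} {q : List Bool} : answer X q = true ↔ q ∈ X := by
  classical exact decide_eq_true_iff

open Classical in
theorem ite_mem_eq_answer {α : Type} (f : Bool → α) (X : Lang) (q : List Bool) :
    (if q ∈ X then f true else f false) = f (answer X q) := by
  by_cases h : q ∈ X <;> simp [answer, h]

/-- What `g` assigns to the answers of `X` about `0q` and `1q`. -/
noncomputable def outcome (g : Bool → Bool → Bool ⊕ Bool) (X : Lang) (q : List Bool) :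
    Bool ⊕ Bool :=
  g (answer X (false :: q)) (answer X (true :: q))

theorem accepting_doubleCfg {c : M.Cfg} :
    (M.double g).Accepting (doubleCfg M g c) ↔ M.Accepting c := by
  simp only [Accepting, double, doubleCfg, stageCfg]
  cases M.prog c.state <;> simp

theorem halted_doubleCfg {c : M.Cfg} : (M.double g).Halted (doubleCfg M g c) ↔ M.Halted c := by
  simp only [Halted, double, doubleCfg, stageCfg]
  cases M.prog c.state <;> simp

theorem accepting_verdict {q : M.Q} {s : Sym M.W} {v b : Bool}
    {T : Fin (M.k + 2) → Tape (Sym M.W)} :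
    (M.double g).Accepting (stageCfg M g (q, .halt, s, v, b) T) ↔ v = true := by
  cases v <;> simp [Accepting, double, stageCfg]

theorem halted_verdict {q : M.Q} {s : Sym M.W} {v b : Bool}
    {T : Fin (M.k + 2) → Tape (Sym M.W)} :
    (M.double g).Halted (stageCfg M g (q, .halt, s, v, b) T) := by
  cases v <;> simp [Halted, double, stageCfg]

/-- The oracles `X` and `X'` need no relation, since a step that is not a query consults neither. -/
theorem step_doubleCfg (X' : Lang) {c : M.Cfg} (h : ∀ yes no, M.prog c.state ≠ .query yes no) :
    (M.double g).step X (doubleCfg M g c) = doubleCfg M g (M.step X' c) := by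
  simp only [step, double, doubleCfg, stageCfg]
  cases hp : M.prog c.state with
  | query yes no => exact (h yes no hp).elim
  | _ => rfl

theorem applyAction_queryTapeAct {k : ℕ} {W : Type} (T : Fin (k + 2) → Tape (Sym W))
    (a : Sym W × Option Dir) :
    (fun i => applyAction (T i) (queryTapeAct (fun i => (T i).head) a i)) =
      Function.update T 1 (applyAction (T 1) a) := by
  funext i
  by_cases h : i = 1
  · subst h
    simp [queryTapeAct]
  · simp [queryTapeAct, h, applyAction]

theorem scannedWord_write_move_left {W : Type} (T : Tape (Sym W)) (b : Bool) :
    scannedWord ((T.move Dir.left).write (bit b)) = b :: scannedWord T := by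
  obtain ⟨h, l, r⟩ := T
  induction r using ListBlank.induction_on with
  | _ r => rfl

section Stages

variable {q yes no : M.Q} {s : Sym M.W} {a b : Bool} {T : Fin (M.k + 2) → Tape (Sym M.W)}

theorem step_sim (h : M.prog q = .query yes no) :
    (M.double g).step X (stageCfg M g (q, .sim, s, a, b) T) =
      stageCfg M g (q, .peek, none, false, false)
        (Function.update T 1 (applyAction (T 1) ((T 1).head, some Dir.left))) := by
  simp only [step, double, stageCfg, h]
  exact congrArg (Cfg.mk _) (applyAction_queryTapeAct T _)

theorem step_peek (h : M.prog q = .query yes no) :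
    (M.double g).step X (stageCfg M g (q, .peek, s, a, b) T) =
      stageCfg M g (q, .ask₀, (T 1).head, false, false)
        (Function.update T 1 (applyAction (T 1) (bit false, none))) := by
  simp only [step, double, stageCfg, h]
  exact congrArg (Cfg.mk _) (applyAction_queryTapeAct T _)

theorem step_ask₀ (h : M.prog q = .query yes no) :
    (M.double g).step X (stageCfg M g (q, .ask₀, s, a, b) T) =
      stageCfg M g (q, .flip, s, answer X (scannedWord (T 1)), false) T := by
  simp only [step, double, stageCfg, h]
  exact congrArg (stageCfg M g · T) (ite_mem_eq_answer (fun v => (q, Stage.flip, s, v, false)) _ _)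

theorem step_flip (h : M.prog q = .query yes no) :
    (M.double g).step X (stageCfg M g (q, .flip, s, a, b) T) =
      stageCfg M g (q, .ask₁, s, a, false)
        (Function.update T 1 (applyAction (T 1) (bit true, none))) := by
  simp only [step, double, stageCfg, h]
  exact congrArg (Cfg.mk _) (applyAction_queryTapeAct T _)

theorem step_ask₁ (h : M.prog q = .query yes no) :
    (M.double g).step X (stageCfg M g (q, .ask₁, s, a, b) T) =
      stageCfg M g (q, .restore, s, a, answer X (scannedWord (T 1))) T := by
  simp only [step, double, stageCfg, h]
  exact congrArg (stageCfg M g · T) (ite_mem_eq_answer (fun v => (q, Stage.restore, s, a, v)) _ _)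

theorem step_restore (h : M.prog q = .query yes no) :
    (M.double g).step X (stageCfg M g (q, .restore, s, a, b) T) =
      stageCfg M g (continuation none yes no (g a b))
        (Function.update T 1 (applyAction (T 1) (s, some Dir.right))) := by
  simp only [step, double, stageCfg, h]
  exact congrArg (Cfg.mk _) (applyAction_queryTapeAct T _)

end Stages

/-- The symbol overwritten left of the query word is kept in the state and written back, so the six
steps leave every tape as it was, whatever that cell held. -/
theorem step_iterate_query {c : M.Cfg} {yes no : M.Q} (h : M.prog c.state = .query yes no) :
    ((M.double g).step X)^[6] (doubleCfg M g c) =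
      stageCfg M g (continuation none yes no (outcome g X (scannedWord (c.tape 1)))) c.tape := by
  simp only [Function.iterate_succ_apply, Function.iterate_zero_apply, doubleCfg]
  rw [step_sim h, step_peek h, step_ask₀ h, step_flip h, step_ask₁ h, step_restore h]
  have hw : ∀ (T : Tape (Sym M.W)) (u v : Sym M.W), (T.write u).write v = T.write v :=
    fun _ _ _ => rfl
  simp only [Function.update_self, Function.update_idem, applyAction, Tape.write_self, hw,
    scannedWord_write_move_left]
  rw [Tape.move_left_right, Function.update_eq_self]
  rfl

theorem run_six_query {x : List Bool} {m : ℕ} {c : M.Cfg} {yes no : M.Q}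
    (hm : (M.double g).run X x m = doubleCfg M g c) (h : M.prog c.state = .query yes no) :
    (M.double g).run X x (6 + m) =
      stageCfg M g (continuation none yes no (outcome g X (scannedWord (c.tape 1)))) c.tape := by
  rw [run_add, hm, step_iterate_query h]

theorem run_six_query_of_inl {X' : Lang} {x : List Bool} {m : ℕ} {c : M.Cfg} {yes no : M.Q}
    {v : Bool} (hm : (M.double g).run X x m = doubleCfg M g c)
    (h : M.prog c.state = .query yes no) (hv : outcome g X (scannedWord (c.tape 1)) = .inl v)
    (hX' : v = true ↔ scannedWord (c.tape 1) ∈ X') :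
    (M.double g).run X x (6 + m) = doubleCfg M g (M.step X' c) := by
  rw [run_six_query hm h, hv]
  simp only [step, h, ← hX']
  rfl

/-- The transformed machine follows `M` until it halts with a verdict. -/
theorem run_double {X' : Lang}
    (hX : ∀ q v, outcome g X q = .inl v → (v = true ↔ q ∈ X')) (x : List Bool) (n : ℕ) :
    ∃ m ≤ 6 * n, (M.double g).run X x m = doubleCfg M g (M.run X' x n) ∨
      (M.double g).Halted ((M.double g).run X x m) ∧ ∃ q v, outcome g X q = .inr v := by
  induction n with
  | zero => exact ⟨0, le_rfl, .inl rfl⟩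
  | succ n ih =>
    obtain ⟨m, hmn, hm | hm⟩ := ih
    · have hs : M.run X' x (n + 1) = M.step X' (M.run X' x n) := Function.iterate_succ_apply' _ _ _
      rw [hs]
      by_cases hq : ∃ yes no, M.prog (M.run X' x n).state = .query yes no
      · obtain ⟨yes, no, hq⟩ := hq
        refine ⟨6 + m, by omega, ?_⟩
        cases ho : outcome g X (scannedWord ((M.run X' x n).tape 1)) with
        | inl v => exact .inl (run_six_query_of_inl hm hq ho (hX _ _ ho))
        | inr v =>
          refine .inr ⟨?_, _, _, ho⟩
          rw [run_six_query hm hq, ho]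
          exact halted_verdict
      · push Not at hq
        refine ⟨1 + m, by omega, .inl ?_⟩
        rw [run_add, hm]
        exact step_doubleCfg X' hq
    · exact ⟨m, by omega, .inr hm⟩

theorem PolyTime.double (h : M.PolyTime) (g : Bool → Bool → Bool ⊕ Bool) :
    (M.double g).PolyTime := by
  obtain ⟨p, hp⟩ := h
  refine ⟨6 * p, fun X x => ?_⟩
  have key : ∃ m ≤ 6 * p.eval x.length, (M.double g).Halted ((M.double g).run X x m) := by
    -- For arbitrary `g` and `X`, this choice of `X'` is consistent with every non-verdict outcome.
    -- The bound on `M` holds for every oracle, so also for this one.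
    obtain ⟨m, hm, h | h⟩ := run_double (M := M) (g := g) (X := X)
      (X' := {q | outcome g X q = .inl true}) (fun q v hv => by simp [hv]) x (p.eval x.length)
    · exact ⟨m, hm, h ▸ halted_doubleCfg.2 (hp _ x)⟩
    · exact ⟨m, hm, h.1⟩
  obtain ⟨m, hm, h⟩ := key
  have he : (6 * p).eval x.length = 6 * p.eval x.length := by
    rw [Polynomial.eval_mul]
    exact congrArg (· * _) (Polynomial.eval_ofNat 6 _)
  rw [he, run_eq_of_halted h hm]
  exact h

theorem language_double (h : M.PolyTime) {X' : Lang}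
    (hX : ∀ q, ∃ v, outcome g X q = .inl v ∧ (v = true ↔ q ∈ X')) :
    (M.double g).language X = M.language X' := by
  obtain ⟨p, hp⟩ := h
  ext x
  obtain ⟨m, -, h | ⟨-, q, v, hv⟩⟩ := run_double (M := M) (g := g) (X := X) (X' := X')
    (fun q v hv => by
      obtain ⟨w, hw, hq⟩ := hX q
      rw [hv] at hw
      cases hw
      exact hq) x (p.eval x.length)
  · rw [mem_language_iff_of_halted (hp X' x),
      mem_language_iff_of_halted (h ▸ halted_doubleCfg.2 (hp X' x)), h, accepting_doubleCfg]
  · obtain ⟨w, hw, -⟩ := hX q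
    rw [hv] at hw
    cases hw

/-! ### Positive use of the two answers -/

/-- The first answer is about membership in a complement. If the answers contradict each other,
accept if both are positive and reject if both are negative. -/
def positiveAnswer (a b : Bool) : Bool ⊕ Bool := if a = b then .inr a else .inl b

/-- With a larger oracle, the transformed machine takes the same steps, unless it accepts with the
larger oracle or rejects with the smaller one. -/
theorem run_double_mono {A B : Lang} (hAB : A ⊆ B) (x : List Bool) (n : ℕ) :
    (∃ m, (M.double positiveAnswer).run A x m =
        doubleCfg M positiveAnswer (M.run {q | true :: q ∈ A} x n) ∧
      (M.double positiveAnswer).run B x m =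
        doubleCfg M positiveAnswer (M.run {q | true :: q ∈ A} x n)) ∨
    x ∈ (M.double positiveAnswer).language B ∨ x ∉ (M.double positiveAnswer).language A := by
  induction n with
  | zero => exact .inl ⟨0, rfl, rfl⟩
  | succ n ih =>
    rcases ih with ⟨m, hA, hB⟩ | h
    · have hs : M.run {q | true :: q ∈ A} x (n + 1) =
          M.step {q | true :: q ∈ A} (M.run {q | true :: q ∈ A} x n) :=
        Function.iterate_succ_apply' _ _ _
      rw [hs]
      generalize M.run {q | true :: q ∈ A} x n = c at hA hB
      by_cases hq : ∃ yes no, M.prog c.state = .query yes no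
      · obtain ⟨yes, no, hq⟩ := hq
        have h₀ := @hAB (false :: scannedWord (c.tape 1))
        have h₁ := @hAB (true :: scannedWord (c.tape 1))
        have accept : outcome positiveAnswer B (scannedWord (c.tape 1)) = .inr true →
            x ∈ (M.double positiveAnswer).language B := fun ho => by
          refine ⟨6 + m, ?_⟩
          rw [run_six_query hB hq, ho]
          exact accepting_verdict.2 rfl
        have reject : outcome positiveAnswer A (scannedWord (c.tape 1)) = .inr false →
            x ∉ (M.double positiveAnswer).language A := fun ho => by
          have hr := run_six_query hA hq
          rw [ho] at hr
          rw [mem_language_iff_of_halted (hr ▸ halted_verdict), hr]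
          exact fun h => Bool.noConfusion (accepting_verdict.1 h)
        have agree : ∀ v, outcome positiveAnswer A (scannedWord (c.tape 1)) = .inl v →
            outcome positiveAnswer B (scannedWord (c.tape 1)) = .inl v →
            (v = true ↔ true :: scannedWord (c.tape 1) ∈ A) →
            ∃ m, (M.double positiveAnswer).run A x m =
              doubleCfg M positiveAnswer (M.step {q | true :: q ∈ A} c) ∧
            (M.double positiveAnswer).run B x m =
              doubleCfg M positiveAnswer (M.step {q | true :: q ∈ A} c) :=
          fun v hvA hvB hv => ⟨6 + m, run_six_query_of_inl hA hq hvA hv,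
            run_six_query_of_inl hB hq hvB hv⟩
        simp only [outcome, positiveAnswer, answer] at accept reject agree
        -- If `A` answers no twice, its run rejects; if `B` answers yes twice, its run accepts.
        -- Otherwise `A` has at least one yes and `B` at most one, so `A ⊆ B` makes the two pairs
        -- equal.
        by_cases a₀ : false :: scannedWord (c.tape 1) ∈ A <;>
        by_cases a₁ : true :: scannedWord (c.tape 1) ∈ A <;>
        by_cases b₀ : false :: scannedWord (c.tape 1) ∈ B <;>
        by_cases b₁ : true :: scannedWord (c.tape 1) ∈ B <;>
        simp_all
      · push Not at hq
        refine .inl ⟨1 + m, ?_, ?_⟩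
        · rw [run_add, hA]
          exact step_doubleCfg _ hq
        · rw [run_add, hB]
          exact step_doubleCfg _ hq
    · exact .inr h

/-- After `p(|x|)` simulated steps with the oracle `{q | true :: q ∈ A}`, runs that have not been
separated by a verdict share a halted configuration. -/
theorem PolyTime.positive_double (h : M.PolyTime) : (M.double positiveAnswer).Positive := by
  obtain ⟨p, hp⟩ := h
  intro A B hAB x hx
  rcases run_double_mono hAB x (p.eval x.length) with ⟨m, hA, hB⟩ | h | h
  · have hh := halted_doubleCfg (g := positiveAnswer).2 (hp {q | true :: q ∈ A} x)
    rw [mem_language_iff_of_halted (hA ▸ hh), hA] at hx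
    rw [mem_language_iff_of_halted (hB ▸ hh), hB]
    exact hx
  · exact h
  · exact absurd hx h

end OracleTM

/-! ### The two inclusions -/

theorem mem_PNP_of_turingReduces_DP {L C : Lang} (hC : C ∈ DP) (h : TuringReduces L C) :
    L ∈ PNP := by
  obtain ⟨A, hA, B, hB, rfl⟩ := hC
  obtain ⟨M, hM, rfl⟩ := h
  refine ⟨join fun b => if b then Bᶜ else A, join_mem_NP ?_,
    M.double fun a b => .inl (a && !b), hM.double _, (OracleTM.language_double hM ?_).symm⟩
  · rintro (_ | _)
    exacts [hA, hB]
  · exact fun q => ⟨_, rfl, by simp [OracleTM.answer]⟩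

/-- Against this oracle the two answers always disagree, so no verdict is ever issued and the second
answer is membership in `B`. -/
theorem posTuringReduces_join_compl {L B : Lang} (h : TuringReduces L B) :
    PosTuringReduces L (join fun b => if b then B else Bᶜ) := by
  obtain ⟨M, hM, rfl⟩ := h
  refine ⟨M.double OracleTM.positiveAnswer, hM.double _, hM.positive_double,
    (OracleTM.language_double hM fun q => 
      ⟨OracleTM.answer (join fun b => if b then B else Bᶜ) (true :: q), ?_, ?_⟩).symm⟩
  · by_cases hq : q ∈ B <;> simp [OracleTM.outcome, OracleTM.positiveAnswer, OracleTM.answer, hq]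
  · simp

end PosTuring

theorem theorem1 :
    PosTuring.ReductionClosure PosTuring.PosTuringReduces PosTuring.DP = PosTuring.PNP := by
  ext L
  constructor
  · rintro ⟨C, hC, M, hM, -, hL⟩
    exact PosTuring.mem_PNP_of_turingReduces_DP hC ⟨M, hM, hL⟩
  · rintro ⟨B, hB, h⟩
    exact ⟨_, PosTuring.join_compl_mem_DP hB, PosTuring.posTuringReduces_join_compl h⟩
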